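/- Let $(N_n)_{n\ge 0}$ be a strictly increasing sequence of natural numbers and let $0\le L_n\le N_n$ be integers; put $c_{2,n}=L_n/N_n$ and assume $\liminf_{n\to\infty}c_{2,n}>0$ (so that $L_n,N_n\to\infty$; automatically $\limsup_n c_{2,n}\le 1$; the ratios need not converge). For each $n$ let $Q_n\in\mathbb C^{N_n\times N_n}$ be a deterministic nonnegative definite (Hermitian) matrix, with $\sup_n\|Q_n\|<\infty$, where $\|\cdot\|$ is the spectral norm. On a common probability space let $\tilde W_n\in\mathbb C^{L_n\times N_n}$, $n\ge 0$, be random matrices such that, for each $n$, $\tilde W_n$ consists of $L_n$ rows of an $N_n\times N_n$ Haar-distributed unitary random matrix, i.e. has the law of $L_n$ distinct rows (at fixed positions) of such a matrix; nothing is assumed on the joint law of the $\tilde W_n$ for different $n$. Then for every real $\omega>0$, almost surely, $$\frac1{N_n}\operatorname{tr}\Big(Q_n\big(\tilde W_n^H\tilde W_n+\omega I_{N_n}\big)^{-1}\Big)-\Big(\frac{c_{2,n}}{\omega+1}+\frac{1-c_{2,n}}{\omega}\Big)\frac1{N_n}\operatorname{tr}Q_n\longrightarrow 0\qquad(n\to\infty).$$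 -/

import Mathlib

open MeasureTheory Filter Topology Matrix
open scoped ComplexOrder

/-- The entrywise (product) σ-algebra on complex matrices. -/
noncomputable instance matrixMeasurableSpace (m n : ℕ) : MeasurableSpace (Matrix (Fin m) (Fin n) ℂ) :=
  inferInstanceAs (MeasurableSpace (Fin m → Fin n → ℂ))

/-- The entrywise σ-algebra is the Borel σ-algebra of the entrywise topology. -/
instance matrixBorelSpace (m n : ℕ) : BorelSpace (Matrix (Fin m) (Fin n) ℂ) :=
  inferInstanceAs (BorelSpace (Fin m → Fin n → ℂ))

/-- The spectral norm of a complex square matrix: the operator norm of the linear map that it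
induces on the Hermitian space `ℂⁿ`. -/
noncomputable def matrixSpectralNorm {n : ℕ} (A : Matrix (Fin n) (Fin n) ℂ) : ℝ :=
  ‖Matrix.toEuclideanCLM (n := Fin n) (𝕜 := ℂ) A‖

/-- `μ` is the Haar probability measure on the unitary group `U(N)`, that is, the law of an
`N × N` Haar-distributed unitary random matrix. -/
structure IsHaarUnitaryLaw {N : ℕ} (μ : Measure (Matrix.unitaryGroup (Fin N) ℂ)) : Prop where
  isProbabilityMeasure : IsProbabilityMeasure μ
  isHaarMeasure : μ.IsHaarMeasure

/-- The random matrix `W` consists of `L` rows of an `N × N` Haar-distributed unitary random matrix: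
it has the law of the submatrix formed by `L` distinct rows (selected by the injection `r`) of a
Haar-distributed unitary matrix. -/
structure IsHaarRows {Ω : Type*} [MeasurableSpace Ω] {L N : ℕ}
    (W : Ω → Matrix (Fin L) (Fin N) ℂ) (P : Measure Ω) : Prop where
  aemeasurable : AEMeasurable W P
  exists_map_eq : ∃ (μ : Measure (Matrix.unitaryGroup (Fin N) ℂ)) (r : Fin L ↪ Fin N),
    IsHaarUnitaryLaw μ ∧
      P.map W = μ.map (fun U : Matrix.unitaryGroup (Fin N) ℂ =>
        (U : Matrix (Fin N) (Fin N) ℂ).submatrix r id)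

/-! Almost surely `W * Wᴴ = 1`, so `Wᴴ * W` is an orthogonal projection and the resolvent is affine
in it. The quantity to control is therefore a constant times `(1/N) (tr (Q Wᴴ W) - (L/N) tr Q)`. Its
second moment is `O(1/N²)`, summable since `N` is strictly increasing, so convergence is almost sure
whatever the joint law.

For the moment bound, right invariance of Haar measure absorbs the eigenvectors of `Q`, leaving an
eigenvalue-weighted sum of the centred column masses `∑ l, |U (r l) k|² - L/N`. These are
exchangeable with sum zero, so their covariances are nonpositive and variances suffice
(`integral_sq_sum_le_of_exchangeable`). The same lemma along one column reduces these variances to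
the fourth moment of an entry, which a single invariance of Haar measure bounds. -/

instance unitaryGroup_compactSpace (N : ℕ) : CompactSpace (Matrix.unitaryGroup (Fin N) ℂ) := by
  suffices h : IsCompact
      ((Matrix.unitaryGroup (Fin N) ℂ : Submonoid _) : Set (Matrix (Fin N) (Fin N) ℂ)) from
    isCompact_iff_compactSpace.1 h
  have hK : IsCompact {A : Matrix (Fin N) (Fin N) ℂ | ∀ i j, A i j ∈ Metric.closedBall (0 : ℂ) 1} := by
    have h := isCompact_univ_pi (X := fun _ : Fin N => Fin N → ℂ)
      (s := fun _ => Set.pi Set.univ fun _ => Metric.closedBall (0 : ℂ) 1)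
      (fun _ => isCompact_univ_pi fun _ => isCompact_closedBall _ _)
    have he : {A : Matrix (Fin N) (Fin N) ℂ | ∀ i j, A i j ∈ Metric.closedBall (0 : ℂ) 1}
        = Set.pi Set.univ fun _ => Set.pi Set.univ fun _ => Metric.closedBall (0 : ℂ) 1 :=
      Set.ext fun A => ⟨fun h i _ j _ => h i j, fun h i j => h i trivial j trivial⟩
    rw [he]
    exact h
  refine hK.of_isClosed_subset ?_ ?_
  · have : ((Matrix.unitaryGroup (Fin N) ℂ : Submonoid _) : Set (Matrix (Fin N) (Fin N) ℂ))
        = {A | A * star A = 1} := by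
      ext A
      exact Matrix.mem_unitaryGroup_iff
    rw [this]
    exact isClosed_eq (by fun_prop) continuous_const
  · intro A hA i j
    simpa using entry_norm_bound_of_unitary hA i j

/-- A right translate is again a left Haar probability measure, and that measure is unique. -/
theorem isMulRightInvariant_of_isHaarMeasure_of_compactSpace {G : Type*} [Group G]
    [TopologicalSpace G] [IsTopologicalGroup G] [CompactSpace G] [MeasurableSpace G]
    [BorelSpace G] (μ : Measure G) [IsProbabilityMeasure μ] [μ.IsHaarMeasure] :
    μ.IsMulRightInvariant := by
  refine ⟨fun g => ?_⟩
  have : (Measure.map (· * g) μ).IsHaarMeasure := Measure.isHaarMeasure_map_mul_right μ g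
  have : IsProbabilityMeasure (Measure.map (· * g) μ) :=
    Measure.isProbabilityMeasure_map (measurable_mul_const g).aemeasurable
  exact Measure.isHaarMeasure_eq_of_isProbabilityMeasure _ _

/-! ### Exchangeable variables with sum zero -/

/-- Under full permutation invariance, a quadratic form with vanishing row sums is a nonnegative
multiple of the centering form. -/
theorem sum_mul_mul_le_of_perm_invariant {ι : Type*} [Fintype ι] [DecidableEq ι]
    (M : ι → ι → ℝ) (hsum : ∀ i, ∑ j, M i j = 0)
    (hperm : ∀ (σ : Equiv.Perm ι) (i j : ι), M (σ i) (σ j) = M i j)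
    (hpos : ∀ i, 0 ≤ M i i) (v : ℝ) (hv : ∀ i, M i i ≤ v) (w : ι → ℝ) :
    ∑ i, ∑ j, w i * w j * M i j ≤ 2 * v * ∑ i, w i ^ 2 := by
  rcases isEmpty_or_nonempty ι with h | ⟨⟨i₀⟩⟩
  · simp
  have hv0 : 0 ≤ v := (hpos i₀).trans (hv i₀)
  have hw : 0 ≤ ∑ i, w i ^ 2 := Finset.sum_nonneg fun i _ => sq_nonneg _
  rcases subsingleton_or_nontrivial ι with h | h
  · have h0 : ∀ i j, M i j = 0 := fun i j => by
      have := hsum i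
      rwa [Fintype.sum_subsingleton _ j] at this
    simp only [h0, mul_zero, Finset.sum_const_zero]
    positivity
  obtain ⟨j₀, hj₀⟩ := exists_ne i₀
  have hd : ∀ i, M i i = M i₀ i₀ := fun i => by
    have := hperm (Equiv.swap i i₀) i i
    rw [Equiv.swap_apply_left] at this
    exact this.symm
  have hc : ∀ i j, i ≠ j → M i j = M i₀ j₀ := fun i j hij => by
    have h1 : Equiv.swap i i₀ j ≠ i₀ := by
      rw [Ne, Equiv.swap_apply_eq_iff, Equiv.swap_apply_right]
      exact hij.symm
    -- The first swap sends `i` to `i₀`; the second sends the image of `j` to `j₀` and fixes `i₀`.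
    have := hperm (Equiv.swap (Equiv.swap i i₀ j) j₀ * Equiv.swap i i₀) i j
    rw [Equiv.Perm.mul_apply, Equiv.Perm.mul_apply, Equiv.swap_apply_left,
      Equiv.swap_apply_left, Equiv.swap_apply_of_ne_of_ne h1.symm hj₀.symm] at this
    exact this.symm
  set d := M i₀ i₀
  set c := M i₀ j₀
  have hM : ∀ i j, M i j = c + if i = j then d - c else 0 := fun i j => by
    by_cases hij : i = j
    · subst hij; simp [hd]
    · simp [hij, hc i j hij]
  have hrow : (Fintype.card ι : ℝ) * c + (d - c) = 0 := by
    have := hsum i₀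
    simp only [hM, Finset.sum_add_distrib] at this
    simpa using this
  have hcard : (2 : ℝ) ≤ Fintype.card ι := by
    exact_mod_cast Fintype.one_lt_card
  have hd0 : 0 ≤ d := hpos i₀
  have hdv : d ≤ v := hv i₀
  have hc0 : c ≤ 0 := by
    by_contra! hcp
    nlinarith
  have hkey : ∑ i, ∑ j, w i * w j * M i j = c * (∑ i, w i) ^ 2 + (d - c) * ∑ i, w i ^ 2 := by
    simp only [hM, mul_add, Finset.sum_add_distrib]
    congr 1
    · rw [sq, Finset.sum_mul_sum, Finset.mul_sum]
      refine Finset.sum_congr rfl fun i _ => ?_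
      rw [Finset.mul_sum]
      exact Finset.sum_congr rfl fun j _ => by ring
    · rw [Finset.mul_sum]
      refine Finset.sum_congr rfl fun i _ => ?_
      simp only [mul_ite, mul_zero, Finset.sum_ite_eq, Finset.mem_univ, if_true]
      ring
  rw [hkey]
  have h1 : c * (∑ i, w i) ^ 2 ≤ 0 := mul_nonpos_of_nonpos_of_nonneg hc0 (sq_nonneg _)
  -- With `n ≥ 2` indices, `hrow` gives `-c = d / (n - 1) ≤ d`: hence the factor 2.
  have h2 : d - c ≤ 2 * v := by nlinarith
  nlinarith [mul_le_mul_of_nonneg_right h2 hw]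

/-- Second moment bound for linear combinations of exchangeable variables with sum zero. -/
theorem integral_sq_sum_le_of_exchangeable {ι α : Type*} [Fintype ι] [DecidableEq ι]
    [MeasurableSpace α] (μ : Measure α) (y : ι → α → ℝ)
    (hint : ∀ i j, Integrable (fun a => y i a * y j a) μ) (hsum : ∀ a, ∑ i, y i a = 0)
    (hperm : ∀ (σ : Equiv.Perm ι) (i j : ι),
      ∫ a, y (σ i) a * y (σ j) a ∂μ = ∫ a, y i a * y j a ∂μ)
    (v : ℝ) (hv : ∀ i, ∫ a, y i a ^ 2 ∂μ ≤ v) (w : ι → ℝ) :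
    ∫ a, (∑ i, w i * y i a) ^ 2 ∂μ ≤ 2 * v * ∑ i, w i ^ 2 := by
  have h := sum_mul_mul_le_of_perm_invariant (fun i j => ∫ a, y i a * y j a ∂μ) ?_ hperm ?_ v ?_ w
  · refine le_trans (le_of_eq ?_) h
    have : ∀ a, (∑ i, w i * y i a) ^ 2 = ∑ i, ∑ j, w i * w j * (y i a * y j a) := fun a => by
      rw [sq, Finset.sum_mul_sum]
      exact Finset.sum_congr rfl fun i _ => Finset.sum_congr rfl fun j _ => by ring
    simp only [this]
    rw [integral_finsetSum _ fun i _ => integrable_finsetSum _ fun j _ => (hint i j).const_mul _]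
    refine Finset.sum_congr rfl fun i _ => ?_
    rw [integral_finsetSum _ fun j _ => (hint i j).const_mul _]
    exact Finset.sum_congr rfl fun j _ => integral_const_mul _ _
  · intro i
    rw [← integral_finsetSum _ fun j _ => hint i j]
    simp [← Finset.mul_sum, hsum]
  · exact fun i => integral_nonneg fun a => mul_self_nonneg _
  · intro i
    simpa [sq] using hv i

/-! ### Test unitaries -/

/-- The permutation matrix of `σ`, as a unitary matrix. -/
def permUnitary {N : ℕ} (σ : Equiv.Perm (Fin N)) : Matrix.unitaryGroup (Fin N) ℂ :=
  ⟨(1 : Matrix (Fin N) (Fin N) ℂ).submatrix σ id, by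
    rw [Matrix.mem_unitaryGroup_iff, star_eq_conjTranspose, conjTranspose_submatrix,
      conjTranspose_one]
    refine (submatrix_mul_equiv 1 1 σ (Equiv.refl (Fin N)) σ).trans ?_
    rw [one_mul, submatrix_one_equiv]⟩

theorem permUnitary_mul_apply {N : ℕ} (σ : Equiv.Perm (Fin N))
    (U : Matrix.unitaryGroup (Fin N) ℂ) (i j : Fin N) :
    (permUnitary σ * U : Matrix.unitaryGroup (Fin N) ℂ).1 i j = U.1 (σ i) j := by
  simp [permUnitary, Matrix.mul_apply, Matrix.one_apply]

theorem mul_permUnitary_apply {N : ℕ} (σ : Equiv.Perm (Fin N))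
    (U : Matrix.unitaryGroup (Fin N) ℂ) (i j : Fin N) :
    (U * permUnitary σ⁻¹ : Matrix.unitaryGroup (Fin N) ℂ).1 i j = U.1 i (σ j) := by
  simp [permUnitary, Matrix.mul_apply, Matrix.one_apply, Equiv.symm_apply_eq]

/-- A unitary square root of the transposition matrix of `p` and `q`. -/
noncomputable def sqrtSwapUnitary {N : ℕ} (p q : Fin N) : Matrix.unitaryGroup (Fin N) ℂ :=
  ⟨((1 + Complex.I) / 2) • (1 : Matrix (Fin N) (Fin N) ℂ)
      + ((1 - Complex.I) / 2) • (permUnitary (Equiv.swap p q)).1, by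
    have hstar : star (permUnitary (Equiv.swap p q)).1 = (permUnitary (Equiv.swap p q)).1 := by
      ext i j
      simp only [permUnitary, star_apply, submatrix_apply, id, one_apply]
      by_cases h : Equiv.swap p q j = i
      · have : Equiv.swap p q i = j := by rw [← h, Equiv.swap_apply_self]
        simp [h, this]
      · have : Equiv.swap p q i ≠ j := fun h' => h (by rw [← h', Equiv.swap_apply_self])
        simp [h, this]
    have hsq : (permUnitary (Equiv.swap p q)).1 * (permUnitary (Equiv.swap p q)).1 = 1 := by
      nth_rewrite 2 [← hstar]
      exact Matrix.mem_unitaryGroup_iff.1 (permUnitary (Equiv.swap p q)).2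
    rw [Matrix.mem_unitaryGroup_iff, star_add, star_smul, star_smul, hstar, star_one, add_mul,
      mul_add, mul_add]
    simp only [smul_mul_smul_comm, one_mul, mul_one, hsq]
    have h1 : (1 + Complex.I) / 2 * star ((1 + Complex.I) / 2) = (1 / 2 : ℂ) := by
      apply Complex.ext <;> simp <;> norm_num
    have h2 : (1 - Complex.I) / 2 * star ((1 - Complex.I) / 2) = (1 / 2 : ℂ) := by
      apply Complex.ext <;> simp <;> norm_num
    have h3 : (1 + Complex.I) / 2 * star ((1 - Complex.I) / 2)
        = -((1 - Complex.I) / 2 * star ((1 + Complex.I) / 2)) := by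
      apply Complex.ext <;> simp <;> norm_num
    rw [h1, h2, h3, neg_smul]
    module⟩

theorem sqrtSwapUnitary_mul_apply {N : ℕ} (p q : Fin N)
    (U : Matrix.unitaryGroup (Fin N) ℂ) (i j : Fin N) :
    (sqrtSwapUnitary p q * U : Matrix.unitaryGroup (Fin N) ℂ).1 i j
      = (1 + Complex.I) / 2 * U.1 i j + (1 - Complex.I) / 2 * U.1 (Equiv.swap p q i) j := by
  have : (sqrtSwapUnitary p q * U : Matrix.unitaryGroup (Fin N) ℂ).1
      = ((1 + Complex.I) / 2) • U.1
        + ((1 - Complex.I) / 2) • (permUnitary (Equiv.swap p q) * U :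
            Matrix.unitaryGroup (Fin N) ℂ).1 := by
    simp [sqrtSwapUnitary, add_mul]
  rw [this, Matrix.add_apply, Matrix.smul_apply, Matrix.smul_apply, permUnitary_mul_apply]
  rfl

/-- The two squared moduli are `s/2 ∓ t` with `s = |x|² + |y|²` and `t = Im (x ȳ)`; their squares
sum to `s²/2 + 2t²`, and `t² ≤ |x|² |y|²`. -/
theorem normSq_sq_add_normSq_sq_le (x y : ℂ) :
    Complex.normSq ((1 + Complex.I) / 2 * x + (1 - Complex.I) / 2 * y) ^ 2
      + Complex.normSq ((1 + Complex.I) / 2 * y + (1 - Complex.I) / 2 * x) ^ 2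
    ≤ (Complex.normSq x ^ 2 + Complex.normSq y ^ 2) / 2
      + 3 * (Complex.normSq x * Complex.normSq y) := by
  obtain ⟨a, b⟩ := x
  obtain ⟨c, d⟩ := y
  simp [Complex.normSq_apply]
  nlinarith [sq_nonneg (a * c + b * d), sq_nonneg (a * d - b * c)]

/-! ### Moments of Haar unitary entries -/

section HaarMoments

variable {N : ℕ} (μ : Measure (Matrix.unitaryGroup (Fin N) ℂ))

theorem continuous_unitaryGroup_normSq (i j : Fin N) :
    Continuous fun U : Matrix.unitaryGroup (Fin N) ℂ => Complex.normSq (U.1 i j) :=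
  Complex.continuous_normSq.comp (continuous_subtype_val.matrix_elem i j)

theorem sum_normSq_col (U : Matrix.unitaryGroup (Fin N) ℂ) (j : Fin N) :
    ∑ i, Complex.normSq (U.1 i j) = 1 := by
  have h := congrFun (congrFun (Matrix.mem_unitaryGroup_iff'.1 U.2) j) j
  simp only [Matrix.mul_apply, star_apply, Matrix.one_apply_eq] at h
  have h2 : ((∑ i, Complex.normSq (U.1 i j) : ℝ) : ℂ) = 1 := by
    rw [← h, Complex.ofReal_sum]
    refine Finset.sum_congr rfl fun i _ => ?_
    rw [Complex.normSq_eq_conj_mul_self]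
    rfl
  exact_mod_cast h2

theorem sum_normSq_row (U : Matrix.unitaryGroup (Fin N) ℂ) (i : Fin N) :
    ∑ j, Complex.normSq (U.1 i j) = 1 := by
  have h := congrFun (congrFun (Matrix.mem_unitaryGroup_iff.1 U.2) i) i
  simp only [Matrix.mul_apply, star_apply, Matrix.one_apply_eq] at h
  have h2 : ((∑ j, Complex.normSq (U.1 i j) : ℝ) : ℂ) = 1 := by
    rw [← h, Complex.ofReal_sum]
    refine Finset.sum_congr rfl fun j _ => ?_
    rw [← Complex.mul_conj]
    rfl
  exact_mod_cast h2

theorem integrable_of_continuous_unitaryGroup [IsFiniteMeasure μ]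
    {f : Matrix.unitaryGroup (Fin N) ℂ → ℝ} (hf : Continuous f) : Integrable f μ :=
  hf.integrable_of_hasCompactSupport (HasCompactSupport.of_compactSpace f)

theorem integral_normSq_perm_left [μ.IsHaarMeasure]
    (σ : Equiv.Perm (Fin N)) (f : ℝ → ℝ → ℝ) (i j k : Fin N) :
    ∫ U : Matrix.unitaryGroup (Fin N) ℂ,
        f (Complex.normSq (U.1 (σ i) k)) (Complex.normSq (U.1 (σ j) k)) ∂μ
      = ∫ U : Matrix.unitaryGroup (Fin N) ℂ,
        f (Complex.normSq (U.1 i k)) (Complex.normSq (U.1 j k)) ∂μ := by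
  conv_rhs => rw [← integral_mul_left_eq_self _ (permUnitary σ)]
  simp only [permUnitary_mul_apply]

variable [IsProbabilityMeasure μ] [μ.IsHaarMeasure]

/-- Mixing rows `p` and `q` by `sqrtSwapUnitary` preserves the law; integrating the pointwise
inequality gives `2m ≤ m + 3 E[|U p k|² |U q k|²]` for the fourth moment `m`. -/
theorem integral_normSq_sq_le_three_mul (p q k : Fin N) :
    ∫ U : Matrix.unitaryGroup (Fin N) ℂ, Complex.normSq (U.1 p k) ^ 2 ∂μ
      ≤ 3 * ∫ U : Matrix.unitaryGroup (Fin N) ℂ,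
          Complex.normSq (U.1 p k) * Complex.normSq (U.1 q k) ∂μ := by
  have hq : ∫ U : Matrix.unitaryGroup (Fin N) ℂ, Complex.normSq (U.1 q k) ^ 2 ∂μ
      = ∫ U : Matrix.unitaryGroup (Fin N) ℂ, Complex.normSq (U.1 p k) ^ 2 ∂μ := by
    have := integral_normSq_perm_left μ (Equiv.swap p q) (fun a _ => a ^ 2) p p k
    simpa using this
  have hI := integral_mul_left_eq_self (μ := μ)
    (fun U => Complex.normSq (U.1 p k) ^ 2 + Complex.normSq (U.1 q k) ^ 2) (sqrtSwapUnitary p q)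
  simp only [sqrtSwapUnitary_mul_apply, Equiv.swap_apply_left, Equiv.swap_apply_right] at hI
  have hc := fun i => continuous_unitaryGroup_normSq (N := N) i k
  have hsq : ∀ i, Integrable (fun U : Matrix.unitaryGroup (Fin N) ℂ => Complex.normSq (U.1 i k) ^ 2) μ :=
    fun i => integrable_of_continuous_unitaryGroup μ ((hc i).pow 2)
  have hpq : Integrable (fun U : Matrix.unitaryGroup (Fin N) ℂ =>
      Complex.normSq (U.1 p k) * Complex.normSq (U.1 q k)) μ :=
    integrable_of_continuous_unitaryGroup μ ((hc p).mul (hc q))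
  have he : ∀ i, Continuous fun U : Matrix.unitaryGroup (Fin N) ℂ => U.1 i k :=
    fun i => continuous_subtype_val.matrix_elem i k
  have hle : ∫ U : Matrix.unitaryGroup (Fin N) ℂ,
        (Complex.normSq (U.1 p k) ^ 2 + Complex.normSq (U.1 q k) ^ 2) ∂μ
      ≤ ∫ U : Matrix.unitaryGroup (Fin N) ℂ,
        ((Complex.normSq (U.1 p k) ^ 2 + Complex.normSq (U.1 q k) ^ 2) / 2
          + 3 * (Complex.normSq (U.1 p k) * Complex.normSq (U.1 q k))) ∂μ := by
    rw [← hI]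
    refine integral_mono (integrable_of_continuous_unitaryGroup μ ?_)
      ((((hsq p).add (hsq q)).div_const 2).add (hpq.const_mul 3))
      fun U => normSq_sq_add_normSq_sq_le _ _
    exact ((Complex.continuous_normSq.comp
        ((continuous_const.mul (he p)).add (continuous_const.mul (he q)))).pow 2).add
      ((Complex.continuous_normSq.comp
        ((continuous_const.mul (he q)).add (continuous_const.mul (he p)))).pow 2)
  have hadd : Integrable (fun U : Matrix.unitaryGroup (Fin N) ℂ =>
      (Complex.normSq (U.1 p k) ^ 2 + Complex.normSq (U.1 q k) ^ 2) / 2) μ :=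
    ((hsq p).add (hsq q)).div_const 2
  rw [integral_add hadd (hpq.const_mul 3), integral_div,
    integral_const_mul, integral_add (hsq p) (hsq q), hq] at hle
  linarith

theorem integral_normSq_sq_le (p k : Fin N) :
    ∫ U : Matrix.unitaryGroup (Fin N) ℂ, Complex.normSq (U.1 p k) ^ 2 ∂μ ≤ 3 / (N : ℝ) ^ 2 := by
  have hc := fun i => continuous_unitaryGroup_normSq (N := N) i k
  have hij : ∀ i j, Integrable (fun U : Matrix.unitaryGroup (Fin N) ℂ =>
      Complex.normSq (U.1 i k) * Complex.normSq (U.1 j k)) μ := fun i j =>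
    integrable_of_continuous_unitaryGroup μ ((hc i).mul (hc j))
  have hone : ∑ i, ∑ j, ∫ U : Matrix.unitaryGroup (Fin N) ℂ,
      Complex.normSq (U.1 i k) * Complex.normSq (U.1 j k) ∂μ = 1 := by
    simp only [← integral_finsetSum _ fun j _ => hij _ j]
    rw [← integral_finsetSum _ fun i _ => integrable_finsetSum _ fun j _ => hij i j]
    simp only [← Finset.mul_sum, ← Finset.sum_mul, sum_normSq_col]
    simp
  -- Each of the `N²` terms of `hone`, diagonal included, is at least a third of the fourth moment.
  have hge : ∀ i j, (∫ U : Matrix.unitaryGroup (Fin N) ℂ, Complex.normSq (U.1 p k) ^ 2 ∂μ) / 3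
      ≤ ∫ U : Matrix.unitaryGroup (Fin N) ℂ,
        Complex.normSq (U.1 i k) * Complex.normSq (U.1 j k) ∂μ := fun i j => by
    have h1 := integral_normSq_perm_left μ (Equiv.swap p i) (fun a _ => a ^ 2) p p k
    have h2 := integral_normSq_sq_le_three_mul μ i j k
    simp only [Equiv.swap_apply_left] at h1
    linarith
  have hN : (0 : ℝ) < N := by exact_mod_cast p.pos
  have := Finset.sum_le_sum fun i (_ : i ∈ Finset.univ) =>
    Finset.sum_le_sum fun j (_ : j ∈ Finset.univ) => hge i j
  rw [hone] at this
  simp only [Finset.sum_const, Finset.card_univ, Fintype.card_fin, nsmul_eq_mul] at this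
  rw [le_div_iff₀ (by positivity)]
  linarith

theorem integral_sq_normSq_sub_le (p k : Fin N) :
    ∫ U : Matrix.unitaryGroup (Fin N) ℂ, (Complex.normSq (U.1 p k) - 1 / N) ^ 2 ∂μ
      ≤ 4 / (N : ℝ) ^ 2 := by
  have hc := continuous_unitaryGroup_normSq (N := N) p k
  have hi : Integrable (fun U : Matrix.unitaryGroup (Fin N) ℂ => Complex.normSq (U.1 p k) ^ 2) μ :=
    integrable_of_continuous_unitaryGroup μ (hc.pow 2)
  have hi' : Integrable (fun U : Matrix.unitaryGroup (Fin N) ℂ => (Complex.normSq (U.1 p k) - 1 / N) ^ 2) μ :=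
    integrable_of_continuous_unitaryGroup μ ((hc.sub continuous_const).pow 2)
  calc _ ≤ ∫ U : Matrix.unitaryGroup (Fin N) ℂ,
        (Complex.normSq (U.1 p k) ^ 2 + 1 / (N : ℝ) ^ 2) ∂μ := by
        refine integral_mono hi' (hi.add (integrable_const _)) fun U => ?_
        have h1 := Complex.normSq_nonneg (U.1 p k)
        have h2 : (0 : ℝ) ≤ 1 / N := by positivity
        have h3 : 1 / (N : ℝ) ^ 2 = (1 / N) ^ 2 := by rw [div_pow, one_pow]
        simp only [h3]
        nlinarith [mul_nonneg h1 h2]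
    _ ≤ 3 / (N : ℝ) ^ 2 + 1 / (N : ℝ) ^ 2 := by
        rw [integral_add hi (integrable_const _)]
        simpa using integral_normSq_sq_le μ p k
    _ = _ := by ring

/-- The diagonal entries of the projection onto the span of `L` rows of a Haar unitary matrix have
variance of order `1 / N`. -/
theorem integral_sq_sum_rows_sub_le {L : ℕ} (r : Fin L ↪ Fin N) (k : Fin N) :
    ∫ U : Matrix.unitaryGroup (Fin N) ℂ,
        (∑ l, Complex.normSq (U.1 (r l) k) - L / N) ^ 2 ∂μ ≤ 8 / (N : ℝ) := by
  have hN : (0 : ℝ) < N := by exact_mod_cast k.pos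
  have hc := fun i => continuous_unitaryGroup_normSq (N := N) i k
  have h := integral_sq_sum_le_of_exchangeable μ
    (fun (i : Fin N) (U : Matrix.unitaryGroup (Fin N) ℂ) => Complex.normSq (U.1 i k) - 1 / N)
    (fun i j => integrable_of_continuous_unitaryGroup μ
      (((hc i).sub continuous_const).mul ((hc j).sub continuous_const)))
    (fun U => by
      rw [Finset.sum_sub_distrib, sum_normSq_col]
      simp [hN.ne'])
    (fun σ i j => integral_normSq_perm_left μ σ (fun a b => (a - 1 / N) * (b - 1 / N)) i j k)
    (4 / (N : ℝ) ^ 2) (fun i => integral_sq_normSq_sub_le μ i k)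
    -- Indicator weights of the selected rows, so `∑ w² = L`.
    (fun i => if i ∈ Finset.univ.map r then 1 else 0)
  simp only [ite_mul, one_mul, zero_mul, ite_pow, one_pow, ne_eq, OfNat.ofNat_ne_zero,
    not_false_eq_true, zero_pow, Finset.sum_ite_mem, Finset.univ_inter, Finset.sum_map,
    Finset.sum_sub_distrib, Finset.sum_const, Finset.card_univ, Finset.card_map,
    Fintype.card_fin, nsmul_eq_mul, mul_one] at h
  have hL : (L : ℝ) ≤ N := by
    have := Fintype.card_le_of_embedding r
    simp only [Fintype.card_fin] at this
    exact_mod_cast this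
  calc _ ≤ 2 * (4 / (N : ℝ) ^ 2) * L := by
        simpa only [mul_one_div] using h
    _ ≤ 2 * (4 / (N : ℝ) ^ 2) * N := by gcongr
    _ = 8 / N := by field_simp; norm_num

theorem integral_sq_weighted_sum_rows_le {L : ℕ} (r : Fin L ↪ Fin N) (d : Fin N → ℝ) :
    ∫ U : Matrix.unitaryGroup (Fin N) ℂ,
        (∑ k, d k * (∑ l, Complex.normSq (U.1 (r l) k) - L / N)) ^ 2 ∂μ
      ≤ 16 / (N : ℝ) * ∑ k, d k ^ 2 := by
  have hc : ∀ k, Continuous fun U : Matrix.unitaryGroup (Fin N) ℂ =>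
      ∑ l, Complex.normSq (U.1 (r l) k) - (L : ℝ) / N := fun k =>
    (continuous_finsetSum _ fun l _ => continuous_unitaryGroup_normSq (r l) k).sub continuous_const
  have := isMulRightInvariant_of_isHaarMeasure_of_compactSpace μ
  refine (integral_sq_sum_le_of_exchangeable μ _
    (fun i j => integrable_of_continuous_unitaryGroup μ ((hc i).mul (hc j))) (fun U => ?_)
    (fun σ i j => ?_) (8 / (N : ℝ)) (fun k => integral_sq_sum_rows_sub_le μ r k) d).trans
    (le_of_eq (by ring))
  · rw [Finset.sum_sub_distrib, Finset.sum_comm]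
    simp only [sum_normSq_row, Finset.sum_const, Finset.card_univ, Fintype.card_fin, nsmul_eq_mul,
      mul_one]
    rcases Nat.eq_zero_or_pos N with h | h
    · subst h
      have : L = 0 := by simpa using Fintype.card_le_of_embedding r
      simp [this]
    · have : (N : ℝ) ≠ 0 := by positivity
      field_simp
      simp
  -- Columns are exchangeable by right invariance.
  · conv_rhs => rw [← integral_mul_right_eq_self _ (permUnitary σ⁻¹)]
    simp only [mul_permUnitary_apply]

end HaarMoments

/-! ### Spectral reduction and the resolvent -/

theorem abs_eigenvalues_le_matrixSpectralNorm {N : ℕ} {Q : Matrix (Fin N) (Fin N) ℂ}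
    (hQ : Q.IsHermitian) (k : Fin N) : |hQ.eigenvalues k| ≤ matrixSpectralNorm Q := by
  have h := (Matrix.toEuclideanCLM (n := Fin N) (𝕜 := ℂ) Q).le_opNorm (hQ.eigenvectorBasis k)
  have he : Matrix.toEuclideanCLM (n := Fin N) (𝕜 := ℂ) Q (hQ.eigenvectorBasis k)
      = hQ.eigenvalues k • hQ.eigenvectorBasis k := by
    apply (WithLp.ofLp_injective 2)
    rw [Matrix.ofLp_toEuclideanCLM, hQ.mulVec_eigenvectorBasis k]
    rfl
  rw [he, norm_smul, hQ.eigenvectorBasis.norm_eq_one, mul_one, mul_one] at h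
  exact h

theorem sum_sq_eigenvalues_le {N : ℕ} {Q : Matrix (Fin N) (Fin N) ℂ}
    (hQ : Q.IsHermitian) {C : ℝ} (hC : matrixSpectralNorm Q ≤ C) :
    ∑ k, hQ.eigenvalues k ^ 2 ≤ N * C ^ 2 := by
  calc ∑ k, hQ.eigenvalues k ^ 2 ≤ ∑ _k : Fin N, C ^ 2 := by
        refine Finset.sum_le_sum fun k _ => ?_
        rw [← sq_abs]
        exact pow_le_pow_left₀ (abs_nonneg _)
          ((abs_eigenvalues_le_matrixSpectralNorm hQ k).trans hC) 2
    _ = N * C ^ 2 := by simp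

theorem trace_mul_conjTranspose_mul_self_eq {L N : ℕ} {Q : Matrix (Fin N) (Fin N) ℂ}
    (hQ : Q.IsHermitian) (W : Matrix (Fin L) (Fin N) ℂ) :
    (Q * (Wᴴ * W)).trace = ((∑ k, hQ.eigenvalues k *
      ∑ l, Complex.normSq ((W * hQ.eigenvectorUnitary.1) l k) : ℝ) : ℂ) := by
  set V : Matrix (Fin N) (Fin N) ℂ := hQ.eigenvectorUnitary.1
  have hs : Q = V * diagonal (RCLike.ofReal ∘ hQ.eigenvalues) * Vᴴ := by
    conv_lhs => rw [hQ.spectral_theorem, Unitary.conjStarAlgAut_apply]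
    rfl
  have h1 : (Q * (Wᴴ * W)).trace
      = (diagonal (RCLike.ofReal ∘ hQ.eigenvalues) * ((W * V)ᴴ * (W * V))).trace := by
    conv_lhs => rw [hs]
    rw [Matrix.mul_assoc, Matrix.mul_assoc, Matrix.trace_mul_comm, conjTranspose_mul]
    simp only [Matrix.mul_assoc]
  rw [h1, Matrix.trace]
  simp only [diag_apply, diagonal_mul, Function.comp_apply]
  rw [Complex.ofReal_sum]
  refine Finset.sum_congr rfl fun k _ => ?_
  rw [Complex.ofReal_mul, Complex.ofReal_sum, Matrix.mul_apply]
  congr 1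
  refine Finset.sum_congr rfl fun l _ => ?_
  rw [Complex.normSq_eq_conj_mul_self]
  rfl

theorem inv_conjTranspose_mul_self_add_smul_one {L N : ℕ} {W : Matrix (Fin L) (Fin N) ℂ}
    (hW : W * Wᴴ = 1) {z : ℂ} (hz : z ≠ 0) (hz1 : z + 1 ≠ 0) :
    (Wᴴ * W + z • (1 : Matrix (Fin N) (Fin N) ℂ))⁻¹
      = (1 / z) • (1 : Matrix (Fin N) (Fin N) ℂ) + (1 / (z + 1) - 1 / z) • (Wᴴ * W) := by
  have hP : Wᴴ * W * (Wᴴ * W) = Wᴴ * W := by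
    rw [Matrix.mul_assoc, ← Matrix.mul_assoc W, hW, Matrix.one_mul]
  refine Matrix.inv_eq_right_inv ?_
  simp only [add_mul, mul_add, Matrix.smul_mul, Matrix.mul_smul, Matrix.one_mul, Matrix.mul_one,
    hP, smul_smul]
  match_scalars
  · field_simp
    ring
  · field_simp

theorem submatrix_mul_conjTranspose_self {L N : ℕ} (U : Matrix.unitaryGroup (Fin N) ℂ)
    (r : Fin L ↪ Fin N) :
    (U : Matrix (Fin N) (Fin N) ℂ).submatrix r id
      * ((U : Matrix (Fin N) (Fin N) ℂ).submatrix r id)ᴴ = 1 := by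
  rw [conjTranspose_submatrix]
  refine (submatrix_mul_equiv U.1 U.1ᴴ r (Equiv.refl (Fin N)) r).trans ?_
  have : U.1 * U.1ᴴ = 1 := Matrix.mem_unitaryGroup_iff.1 U.2
  rw [this, submatrix_one_embedding]

/-! ### Transfer to the law of `W` -/

section HaarRows

variable {Ω : Type*} [MeasurableSpace Ω] {P : Measure Ω} {L N : ℕ}
  {W : Ω → Matrix (Fin L) (Fin N) ℂ}

theorem measurable_unitaryGroup_submatrix (r : Fin L ↪ Fin N) :
    Measurable fun U : Matrix.unitaryGroup (Fin N) ℂ =>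
      (U : Matrix (Fin N) (Fin N) ℂ).submatrix r id :=
  (continuous_subtype_val.matrix_submatrix r id).measurable

theorem IsHaarRows.ae_mul_conjTranspose_self (hW : IsHaarRows W P) :
    ∀ᵐ x ∂P, W x * (W x)ᴴ = 1 := by
  obtain ⟨μ, r, -, hmap⟩ := hW.exists_map_eq
  refine ae_of_ae_map (p := fun A => A * Aᴴ = 1) hW.aemeasurable ?_
  have hclosed : IsClosed {A : Matrix (Fin L) (Fin N) ℂ | A * Aᴴ = 1} :=
    isClosed_eq (continuous_id.matrix_mul continuous_id.matrix_conjTranspose) continuous_const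
  rw [hmap, ae_map_iff (measurable_unitaryGroup_submatrix r).aemeasurable hclosed.measurableSet]
  exact ae_of_all _ fun U => submatrix_mul_conjTranspose_self U r

theorem continuous_trace_mul_conjTranspose_mul_self (Q : Matrix (Fin N) (Fin N) ℂ) :
    Continuous fun A : Matrix (Fin L) (Fin N) ℂ => (Q * (Aᴴ * A)).trace := by
  fun_prop

theorem IsHaarRows.lintegral_enorm_trace_sub_sq_le (hW : IsHaarRows W P)
    {Q : Matrix (Fin N) (Fin N) ℂ} (hQ : Q.IsHermitian) {C : ℝ} (hC : matrixSpectralNorm Q ≤ C) :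
    ∫⁻ x, ‖(Q * ((W x)ᴴ * W x)).trace - (L : ℂ) / N * Q.trace‖ₑ ^ 2 ∂P
      ≤ ENNReal.ofReal (16 * C ^ 2) := by
  obtain ⟨μ, r, hμ, hmap⟩ := hW.exists_map_eq
  have := hμ.isProbabilityMeasure
  have := hμ.isHaarMeasure
  have := isMulRightInvariant_of_isHaarMeasure_of_compactSpace μ
  have hG : Measurable fun A : Matrix (Fin L) (Fin N) ℂ =>
      ‖(Q * (Aᴴ * A)).trace - (L : ℂ) / N * Q.trace‖ₑ ^ 2 :=
    (((continuous_trace_mul_conjTranspose_mul_self Q).sub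
      continuous_const).measurable.enorm).pow_const 2
  rw [← lintegral_map' hG.aemeasurable hW.aemeasurable, hmap,
    lintegral_map hG (measurable_unitaryGroup_submatrix r)]
  set Z : Matrix.unitaryGroup (Fin N) ℂ → ℝ := fun U =>
    ∑ k, hQ.eigenvalues k * (∑ l, Complex.normSq (U.1 (r l) k) - L / N) with hZ
  have hZc : Continuous Z := continuous_finsetSum _ fun k _ => continuous_const.mul
    ((continuous_finsetSum _ fun l _ => continuous_unitaryGroup_normSq (r l) k).sub
      continuous_const)
  have hZi : Integrable (fun U => Z U ^ 2) μ :=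
    integrable_of_continuous_unitaryGroup μ (hZc.pow 2)
  have hval : ∀ U : Matrix.unitaryGroup (Fin N) ℂ,
      ‖(Q * (((U : Matrix (Fin N) (Fin N) ℂ).submatrix r id)ᴴ
          * (U : Matrix (Fin N) (Fin N) ℂ).submatrix r id)).trace - (L : ℂ) / N * Q.trace‖ₑ ^ 2
        = ENNReal.ofReal (Z (U * hQ.eigenvectorUnitary) ^ 2) := fun U => by
    have : (Q * (((U : Matrix (Fin N) (Fin N) ℂ).submatrix r id)ᴴ
          * (U : Matrix (Fin N) (Fin N) ℂ).submatrix r id)).trace - (L : ℂ) / N * Q.trace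
        = ((Z (U * hQ.eigenvectorUnitary) : ℝ) : ℂ) := by
      rw [trace_mul_conjTranspose_mul_self_eq hQ, hQ.trace_eq_sum_eigenvalues, hZ]
      simp only [mul_sub, Finset.sum_sub_distrib, Complex.ofReal_sub]
      congr 1
      rw [← Finset.sum_mul, mul_comm]
      simp
    rw [this, ← ofReal_norm, ← ENNReal.ofReal_pow (norm_nonneg _), Complex.norm_real,
      Real.norm_eq_abs, sq_abs]
  simp only [hval]
  -- Right invariance removes the eigenvector matrix.
  rw [lintegral_mul_right_eq_self (fun U => ENNReal.ofReal (Z U ^ 2)),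
    ← ofReal_integral_eq_lintegral_ofReal hZi (ae_of_all _ fun U => sq_nonneg _)]
  refine ENNReal.ofReal_le_ofReal ?_
  refine (integral_sq_weighted_sum_rows_le μ r hQ.eigenvalues).trans ?_
  calc 16 / (N : ℝ) * ∑ k, hQ.eigenvalues k ^ 2 ≤ 16 / (N : ℝ) * (N * C ^ 2) := by
        gcongr
        exact sum_sq_eigenvalues_le hQ hC
    _ = 16 * C ^ 2 * (N / N) := by ring
    _ ≤ 16 * C ^ 2 := mul_le_of_le_one_right (by positivity) (div_self_le_one _)

end HaarRows

/-! ### Almost sure convergence -/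

/-- By Tonelli the series of squares is almost surely finite, so its terms tend to zero; no
independence enters. -/
theorem ae_tendsto_zero_of_tsum_lintegral_sq_ne_top {Ω E : Type*} [MeasurableSpace Ω]
    [NormedAddCommGroup E] {P : Measure Ω} {f : ℕ → Ω → E}
    (hf : ∀ n, AEMeasurable (fun x => ‖f n x‖ₑ ^ 2) P)
    (h : ∑' n, ∫⁻ x, ‖f n x‖ₑ ^ 2 ∂P ≠ ⊤) : ∀ᵐ x ∂P, Tendsto (fun n => f n x) atTop (𝓝 0) := by
  rw [← lintegral_tsum hf] at h
  filter_upwards [ae_lt_top' (AEMeasurable.tsum hf) h] with x hx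
  have h2 := ENNReal.tendsto_atTop_zero_of_tsum_ne_top hx.ne
  rw [tendsto_zero_iff_norm_tendsto_zero]
  have h3 := (ENNReal.tendsto_toReal ENNReal.zero_ne_top).comp h2
  have h4 := h3.sqrt
  simpa [Function.comp_def, Real.sqrt_sq] using h4

theorem lemma5 {Ω : Type*} [MeasurableSpace Ω] (P : Measure Ω) [IsProbabilityMeasure P]
    (N L : ℕ → ℕ) (hN : StrictMono N) (hLN : ∀ n, L n ≤ N n)
    (hc₂ : 0 < liminf (fun n => (L n : ℝ) / (N n : ℝ)) atTop)
    (Q : ∀ n, Matrix (Fin (N n)) (Fin (N n)) ℂ) (hQ : ∀ n, (Q n).PosSemidef)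
    (hQb : ∃ C : ℝ, ∀ n, matrixSpectralNorm (Q n) ≤ C)
    (W : ∀ n, Ω → Matrix (Fin (L n)) (Fin (N n)) ℂ) (hW : ∀ n, IsHaarRows (W n) P)
    (ω : ℝ) (hω : 0 < ω) :
    ∀ᵐ x ∂P, Tendsto
      (fun n =>
        (1 / (N n : ℂ)) * (Q n * ((W n x)ᴴ * W n x + (ω : ℂ) • (1 : Matrix (Fin (N n)) (Fin (N n)) ℂ))⁻¹).trace
          - (((L n : ℂ) / (N n : ℂ)) / ((ω : ℂ) + 1) + (1 - (L n : ℂ) / (N n : ℂ)) / (ω : ℂ))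
            * ((1 / (N n : ℂ)) * (Q n).trace))
      atTop (𝓝 0) := by
  obtain ⟨C, hC⟩ := hQb
  have hω0 : (ω : ℂ) ≠ 0 := by exact_mod_cast hω.ne'
  have hω1 : (ω : ℂ) + 1 ≠ 0 := by exact_mod_cast (by positivity : ω + 1 ≠ 0)
  set G : ∀ n, Ω → ℂ := fun n x => (1 / (N n : ℂ)) *
    ((Q n * ((W n x)ᴴ * W n x)).trace - (L n : ℂ) / N n * (Q n).trace) with hG
  have hGm : ∀ n, AEMeasurable (fun x => ‖G n x‖ₑ ^ 2) P := fun n =>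
    ((((continuous_trace_mul_conjTranspose_mul_self (Q n)).measurable.comp_aemeasurable
      (hW n).aemeasurable).sub_const _).const_mul _).enorm.pow_const 2
  have hGb : ∀ n, ∫⁻ x, ‖G n x‖ₑ ^ 2 ∂P
      ≤ ENNReal.ofReal (16 * C ^ 2 * (1 / (N n : ℝ) ^ 2)) := fun n => by
    have he : ‖1 / (N n : ℂ)‖ₑ ^ 2 = ENNReal.ofReal (1 / (N n : ℝ) ^ 2) := by
      rw [← ofReal_norm, ← ENNReal.ofReal_pow (norm_nonneg _)]
      simp
    simp only [hG, enorm_mul, mul_pow]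
    rw [lintegral_const_mul' _ _ (by rw [he]; exact ENNReal.ofReal_ne_top), he,
      mul_comm (16 * C ^ 2), ENNReal.ofReal_mul (by positivity)]
    gcongr
    exact (hW n).lintegral_enorm_trace_sub_sq_le (hQ n).isHermitian (hC n)
  have hsum : Summable fun n => 16 * C ^ 2 * (1 / (N n : ℝ) ^ 2) :=
    ((Real.summable_one_div_nat_pow.2 one_lt_two).comp_injective hN.injective).mul_left _
  have hlim : ∀ᵐ x ∂P, Tendsto (fun n => G n x) atTop (𝓝 0) := by
    refine ae_tendsto_zero_of_tsum_lintegral_sq_ne_top hGm ?_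
    refine ne_top_of_le_ne_top ?_ (ENNReal.tsum_le_tsum hGb)
    exact hsum.tsum_ofReal_ne_top
  filter_upwards [hlim, ae_all_iff.2 fun n => (hW n).ae_mul_conjTranspose_self] with x hx hWx
  have := hx.const_mul (1 / ((ω : ℂ) + 1) - 1 / ω)
  rw [mul_zero] at this
  refine this.congr fun n => ?_
  rw [inv_conjTranspose_mul_self_add_smul_one (hWx n) hω0 hω1, mul_add, Matrix.trace_add,
    Matrix.mul_smul, Matrix.mul_smul, Matrix.trace_smul, Matrix.trace_smul, Matrix.mul_one, hG,
    smul_eq_mul, smul_eq_mul]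
  ring
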